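/- Let $1\le n<m$ and let $A\in\mathbb{R}^{m\times n}$ have full column rank and all rows nonzero. Matrices carry the operator norm induced by the Euclidean norms. Let $\mathscr{D}$ be the set of diagonal $m\times m$ matrices with positive diagonal entries, $\mathcal{S}$ the set of signature matrices $\operatorname{Diag}(s)$, $s\in\{-1,1\}^m$, and $\mathbb{R}^m_{++}$ the set of vectors with all entries positive. Put $$\overline\chi(A):=\sup_{D\in\mathscr{D}}\|A(A^{\mathsf T}DA)^{-1}A^{\mathsf T}D\|.$$ For linear subspaces $L,L'\subseteq\mathbb{R}^m$ of the same dimension put $\operatorname{dist}(L,L'):=\|\Pi_L-\Pi_{L'}\|$, where $\Pi_L$ is the orthogonal projection onto $L$. For $B\in\mathbb{R}^{m\times n}$ of full column rank with $L:=B(\mathbb{R}^n)$ satisfying $L\cap\mathbb{R}^m_{++}\neq\emptyset$, the Grassmannian condition number of $B$ is $$\mathcal{G}(B):=\frac{1}{\min\{\operatorname{dist}(L,L') : \dim L'=\dim L,\ L'\cap\mathbb{R}^m_{++}=\emptyset\}}.$$ Then $\overline\chi(A)$ is finite, for every $S\in\mathcal{S}$ with $SA(\mathbb{R}^n)\cap\mathbb{R}^m_{++}\neq\emptyset$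 the minimum defining $\mathcal{G}(SA)$ is attained and positive, and $$\overline\chi(A)=\max_{S\in\mathcal{S},\ SA(\mathbb{R}^n)\cap\mathbb{R}^m_{++}\neq\emptyset}\mathcal{G}(SA),$$ where the maximum is over a nonempty set and is attained. -/

import Mathlib

noncomputable section

/-- The operator norm of a square real matrix induced by the Euclidean norm. -/
def opNorm {m : ℕ} (M : Matrix (Fin m) (Fin m) ℝ) : ℝ :=
  ‖Matrix.toEuclideanCLM (𝕜 := ℝ) M‖

/-- Diagonal `m × m` matrices with positive diagonal entries. -/
def posDiag (m : ℕ) : Set (Matrix (Fin m) (Fin m) ℝ) :=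
  {D | ∃ d : Fin m → ℝ, (∀ i, 0 < d i) ∧ D = Matrix.diagonal d}

/-- Signature matrices: diagonal matrices with diagonal entries in `{-1, 1}`. -/
def signatures (m : ℕ) : Set (Matrix (Fin m) (Fin m) ℝ) :=
  {S | ∃ s : Fin m → ℝ, (∀ i, s i = 1 ∨ s i = -1) ∧ S = Matrix.diagonal s}

/-- The weighted pseudo-inverse `(Aᵀ D A)⁻¹ Aᵀ D`. -/
def weightedPinv {m n : ℕ} (A : Matrix (Fin m) (Fin n) ℝ) (D : Matrix (Fin m) (Fin m) ℝ) :
    Matrix (Fin n) (Fin m) ℝ :=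
  (A.transpose * D * A)⁻¹ * A.transpose * D

/-- The set of norms of the weighted projections `A (Aᵀ D A)⁻¹ Aᵀ D`. -/
def chiBarSet {m n : ℕ} (A : Matrix (Fin m) (Fin n) ℝ) : Set ℝ :=
  {r | ∃ D ∈ posDiag m, r = opNorm (A * weightedPinv A D)}

/-- The condition measure `χ̄(A)`, the supremum of the norms of the weighted projections. -/
def chiBar {m n : ℕ} (A : Matrix (Fin m) (Fin n) ℝ) : ℝ :=
  sSup (chiBarSet A)

/-- The image `A(ℝⁿ)` as a subspace of Euclidean space `ℝᵐ`. -/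
def imageSpace {m n : ℕ} (A : Matrix (Fin m) (Fin n) ℝ) :
    Submodule ℝ (EuclideanSpace ℝ (Fin m)) :=
  LinearMap.range (Matrix.toEuclideanLin A)

/-- `L ∩ ℝᵐ₊₊ ≠ ∅`. -/
def MeetsPos {m : ℕ} (L : Submodule ℝ (EuclideanSpace ℝ (Fin m))) : Prop :=
  ∃ y ∈ L, ∀ i, 0 < y i

/-- The Grassmannian distance: the operator norm of the difference of the
orthogonal projections. -/
def grassDist {m : ℕ} (L L' : Submodule ℝ (EuclideanSpace ℝ (Fin m))) : ℝ :=
  ‖L.starProjection - L'.starProjection‖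

/-- Distances from `L` to the subspaces of the same dimension that contain no positive vector. -/
def illPosedDistances {m : ℕ} (L : Submodule ℝ (EuclideanSpace ℝ (Fin m))) : Set ℝ :=
  {r | ∃ L' : Submodule ℝ (EuclideanSpace ℝ (Fin m)),
    Module.finrank ℝ L' = Module.finrank ℝ L ∧ ¬ MeetsPos L' ∧ r = grassDist L L'}

/-- The Grassmannian condition number of `A` (meaningful when `A(ℝⁿ)` contains a positive
vector). -/
def grassCond {m n : ℕ} (A : Matrix (Fin m) (Fin n) ℝ) : ℝ :=
  1 / sInf (illPosedDistances (imageSpace A))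

end

/-! Write `L` for the image of `A`, `Π` for the projection onto `L`. Both sides are best constants
in inequalities `‖w‖ ≤ C ‖Π w‖`.

By separation, `L'` misses the open positive orthant iff `L'ᗮ` contains a nonnegative unit vector
`v`. Then `‖Π v‖ ≤ dist(L, L')`, and rotating `L` in one plane gives equality. So the condition
number of `L` is the least `C` valid for all `w ≥ 0` (`exists_isLeast_illPosedDistances`,
`grassCond_spec`).

The transpose of `A (Aᵀ D A)⁻¹ Aᵀ D` is the oblique projection onto `D L` along `Lᗮ`, so its norm is
the least `C ≥ 0` valid on `D L` (`norm_diagonal_le_opNorm_mul`, `opNorm_mul_weightedPinv_le`).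

As `D` varies, the sets `D L` sweep out the vectors whose sign pattern occurs in `L`. A signature
`S` is an isometry that turns a pattern into the nonnegative orthant, which matches the two families
of inequalities; zero entries are handled by perturbation. Finitely many signatures make the maximum
attained. -/

open scoped InnerProductSpace

/-! ### Projections onto subspaces differing in one direction -/

section RankOnePerturbation

variable {E : Type*} [NormedAddCommGroup E] [InnerProductSpace ℝ E]

theorem starProjection_sup_span_singleton {L M : Submodule ℝ E}
    [L.HasOrthogonalProjection] [M.HasOrthogonalProjection] {a : E} (hL : L = M ⊔ ℝ ∙ a)
    (ha : ‖a‖ = 1) (haM : a ∈ Mᗮ) (x : E) :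
    L.starProjection x = M.starProjection x + ⟪a, x⟫_ℝ • a := by
  apply Submodule.eq_starProjection_of_mem_orthogonal
  · rw [hL]
    exact Submodule.add_mem_sup (Submodule.starProjection_apply_mem M x)
      (Submodule.smul_mem _ _ (Submodule.mem_span_singleton_self a))
  · rw [hL, ← Submodule.inf_orthogonal, Submodule.mem_inf]
    constructor
    · rw [← sub_sub]
      exact Submodule.sub_mem _ (Submodule.sub_starProjection_mem_orthogonal x)
        (Submodule.smul_mem _ _ haM)
    · rw [Submodule.mem_orthogonal_singleton_iff_inner_right]
      have h0 : ⟪a, M.starProjection x⟫_ℝ = 0 :=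
        Submodule.inner_left_of_mem_orthogonal (Submodule.starProjection_apply_mem M x) haM
      simp [inner_sub_right, inner_add_right, inner_smul_right, h0, ha]

theorem finrank_sup_span_singleton [FiniteDimensional ℝ E] (M : Submodule ℝ E)
    {a : E} (ha : ‖a‖ = 1) (haM : a ∈ Mᗮ) :
    Module.finrank ℝ (M ⊔ ℝ ∙ a : Submodule ℝ E) = Module.finrank ℝ M + 1 := by
  have hne : a ≠ 0 := by rintro rfl; simp at ha
  have h := Submodule.finrank_sup_add_finrank_inf_eq M (ℝ ∙ a)
  have hd : M ⊓ (ℝ ∙ a) = ⊥ := by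
    rw [eq_bot_iff]
    refine le_trans (inf_le_inf_left M ?_) (Submodule.inf_orthogonal_eq_bot M).le
    rwa [Submodule.span_singleton_le_iff_mem]
  rw [hd, finrank_bot, finrank_span_singleton hne] at h
  simpa using h

/-- The difference of the projections onto two lines has norm the sine of their angle. -/
theorem norm_inner_smul_sub_inner_smul_le {a b : E} (ha : ‖a‖ = 1) (hb : ‖b‖ = 1)
    {s : ℝ} (hs : 0 < s) (hab : ⟪a, b⟫_ℝ ^ 2 + s ^ 2 = 1) (x : E) :
    ‖⟪a, x⟫_ℝ • a - ⟪b, x⟫_ℝ • b‖ ≤ s * ‖x‖ := by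
  set α := ⟪a, x⟫_ℝ with hα
  set β := ⟪b, x⟫_ℝ with hβ
  set c := ⟪a, b⟫_ℝ with hc
  have haa : ⟪a, a⟫_ℝ = 1 := by rw [real_inner_self_eq_norm_sq, ha]; norm_num
  have hbb : ⟪b, b⟫_ℝ = 1 := by rw [real_inner_self_eq_norm_sq, hb]; norm_num
  have hba : ⟪b, a⟫_ℝ = c := real_inner_comm _ _
  have hxa : ⟪x, a⟫_ℝ = α := real_inner_comm _ _
  have hxb : ⟪x, b⟫_ℝ = β := real_inner_comm _ _
  have h1 : ‖α • a - β • b‖ ^ 2 = α ^ 2 + β ^ 2 - 2 * α * β * c := by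
    rw [← real_inner_self_eq_norm_sq]
    simp only [inner_sub_left, inner_sub_right, real_inner_smul_left, real_inner_smul_right,
      haa, hbb, hba, ← hc]
    ring
  -- This vector is `s ^ 2` times the component of `x` orthogonal to the span of `a` and `b`; its
  -- squared norm is the product in `h3`.
  have h2 : 0 ≤ ‖(s ^ 2) • x - (α - β * c) • a - (β - α * c) • b‖ ^ 2 := sq_nonneg _
  rw [← real_inner_self_eq_norm_sq] at h2
  simp only [inner_sub_left, inner_sub_right, real_inner_smul_left, real_inner_smul_right,
      hba, hxa, hxb, ← hc, ← hα, ← hβ, real_inner_self_eq_norm_sq] at h2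
  have h3 : 0 ≤ s ^ 2 * (s ^ 2 * ‖x‖ ^ 2 - (α ^ 2 + β ^ 2 - 2 * α * β * c)) := by
    have hs2 : s ^ 2 = 1 - c ^ 2 := by linarith
    simp only [norm_smul, ha, hb, mul_pow, mul_one, Real.norm_eq_abs, sq_abs] at h2
    rw [hs2] at h2 ⊢
    linarith
  have h4 := nonneg_of_mul_nonneg_right h3 (by positivity)
  apply le_of_sq_le_sq _ (by positivity)
  rw [h1, mul_pow]
  linarith

end RankOnePerturbation

/-! ### Distance to ill-posedness -/

section IllPosed

variable {m : ℕ}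

/-- Separate the open orthant from `L`: a functional bounded below on a subspace vanishes on it, and
one negative on the orthant has nonpositive coefficients. Its negative, normalised, is `v`. -/
theorem exists_nonneg_mem_orthogonal_of_not_meetsPos
    {L : Submodule ℝ (EuclideanSpace ℝ (Fin m))} (h : ¬ MeetsPos L) :
    ∃ v ∈ Lᗮ, ‖v‖ = 1 ∧ ∀ i, 0 ≤ v i := by
  have hopen : IsOpen {y : EuclideanSpace ℝ (Fin m) | ∀ i, 0 < y i} := by
    simp only [Set.ofPred_forall]
    exact isOpen_iInter_of_finite fun i => isOpen_lt continuous_const (by fun_prop)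
  have hconv : Convex ℝ {y : EuclideanSpace ℝ (Fin m) | ∀ i, 0 < y i} := by
    intro x hx y hy a b ha hb hab i
    rcases ha.eq_or_lt with rfl | ha
    · have : b = 1 := by linarith
      subst this
      simpa using hy i
    · have h1 := mul_pos ha (hx i)
      have h2 := mul_nonneg hb (hy i).le
      simpa using by linarith
  have hdisj : Disjoint {y : EuclideanSpace ℝ (Fin m) | ∀ i, 0 < y i} (L : Set _) := by
    rw [Set.disjoint_left]
    exact fun y hy hyL => h ⟨y, hyL, hy⟩
  obtain ⟨f, u, hf, hu⟩ := geometric_hahn_banach_open hconv hopen L.convex hdisj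
  have hu0 : u ≤ 0 := by simpa using hu 0 L.zero_mem
  set w := (InnerProductSpace.toDual ℝ (EuclideanSpace ℝ (Fin m))).symm f with hw
  have hfw : ∀ x, f x = ⟪w, x⟫_ℝ := fun x => by simp [hw]
  have hL : ∀ x ∈ L, f x = 0 := by
    intro x hx
    by_contra hne
    have := hu (((u - 1) / f x) • x) (L.smul_mem _ hx)
    rw [map_smul, smul_eq_mul, div_mul_cancel₀ _ hne] at this
    linarith
  have hone : f (WithLp.toLp 2 fun _ => 1) < 0 := (hf _ (by intro i; simp)).trans_le hu0
  have hwne : w ≠ 0 := by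
    intro h0
    rw [hfw, h0, inner_zero_left] at hone
    exact lt_irrefl _ hone
  have hwi : ∀ i, w i ≤ 0 := by
    intro i
    have hlim : ∀ ε : ℝ, 0 < ε →
        f (EuclideanSpace.single i 1) + ε * f (WithLp.toLp 2 fun _ => 1) ≤ 0 := by
      intro ε hε
      have := (hf (EuclideanSpace.single i 1 + ε • (WithLp.toLp 2 fun _ => 1)) (by
        intro j
        by_cases hj : j = i
        · subst hj; simp; positivity
        · simp [hj, hε])).trans_le hu0
      simpa using this.le
    have h1 : f (EuclideanSpace.single i 1) ≤ 0 := by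
      by_contra! hpos
      -- This `ε` makes the left side of `hlim` half of `f (EuclideanSpace.single i 1)`, still
      -- positive.
      have := hlim (f (EuclideanSpace.single i 1) / (2 * -f (WithLp.toLp 2 fun _ => 1)))
        (by apply div_pos hpos; linarith)
      have hne : f (WithLp.toLp 2 fun _ => 1) ≠ 0 := hone.ne
      have h2 : f (EuclideanSpace.single i 1) / (2 * -f (WithLp.toLp 2 fun _ => 1))
          * f (WithLp.toLp 2 fun _ => 1) = - f (EuclideanSpace.single i 1) / 2 := by
        field_simp
      linarith
    rw [hfw] at h1
    simpa [EuclideanSpace.inner_single_right] using h1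
  refine ⟨-(‖w‖⁻¹ • w), ?_, ?_, ?_⟩
  · refine Submodule.neg_mem _ (Submodule.smul_mem _ _ ?_)
    rw [Submodule.mem_orthogonal']
    exact fun x hx => (hfw x).symm.trans (hL x hx)
  · rw [norm_neg, norm_smul, norm_inv, norm_norm, inv_mul_cancel₀ (norm_ne_zero_iff.2 hwne)]
  · intro i
    have : ‖w‖⁻¹ * w i ≤ 0 := mul_nonpos_of_nonneg_of_nonpos (by positivity) (hwi i)
    simpa using this

theorem inner_pos_of_pos_of_nonneg {y v : EuclideanSpace ℝ (Fin m)} (hy : ∀ i, 0 < y i)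
    (hv : ∀ i, 0 ≤ v i) (hne : v ≠ 0) : 0 < ⟪y, v⟫_ℝ := by
  obtain ⟨i, hi⟩ : ∃ i, v i ≠ 0 := by
    by_contra! h
    exact hne (by ext i; simpa using h i)
  simp only [PiLp.inner_apply, RCLike.inner_apply, conj_trivial]
  exact Finset.sum_pos' (fun j _ => mul_nonneg (hv j) (hy j).le)
    ⟨i, Finset.mem_univ i, mul_pos ((hv i).lt_of_ne' hi) (hy i)⟩

theorem not_meetsPos_of_mem_orthogonal {L : Submodule ℝ (EuclideanSpace ℝ (Fin m))}
    {v : EuclideanSpace ℝ (Fin m)} (hvL : v ∈ Lᗮ) (hv : ∀ i, 0 ≤ v i) (hne : v ≠ 0) :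
    ¬ MeetsPos L := by
  rintro ⟨y, hyL, hy⟩
  exact (inner_pos_of_pos_of_nonneg hy hv hne).ne' (Submodule.inner_right_of_mem_orthogonal hyL hvL)

theorem norm_starProjection_le_grassDist (L : Submodule ℝ (EuclideanSpace ℝ (Fin m)))
    {L' : Submodule ℝ (EuclideanSpace ℝ (Fin m))} {v : EuclideanSpace ℝ (Fin m)}
    (hv : v ∈ L'ᗮ) (hv1 : ‖v‖ = 1) : ‖L.starProjection v‖ ≤ grassDist L L' := by
  have h := (L.starProjection - L'.starProjection).le_opNorm v
  rw [sub_apply, (Submodule.starProjection_apply_eq_zero_iff _).2 hv, sub_zero,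
    hv1, mul_one] at h
  exact h

/-- Rotating `L` within a plane makes it orthogonal to a prescribed unit vector `v`. -/
theorem exists_finrank_eq_mem_orthogonal_grassDist_le {L : Submodule ℝ (EuclideanSpace ℝ (Fin m))}
    (hL : Module.finrank ℝ L < m) {v : EuclideanSpace ℝ (Fin m)} (hv : ‖v‖ = 1)
    (hp : L.starProjection v ≠ 0) :
    ∃ L' : Submodule ℝ (EuclideanSpace ℝ (Fin m)), Module.finrank ℝ L' = Module.finrank ℝ L ∧
      v ∈ L'ᗮ ∧ grassDist L L' ≤ ‖L.starProjection v‖ := by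
  set p := L.starProjection v with hpdef
  set q := v - p with hqdef
  have hpL : p ∈ L := Submodule.starProjection_apply_mem L v
  have hqL : q ∈ Lᗮ := Submodule.sub_starProjection_mem_orthogonal v
  set s := ‖p‖ with hsdef
  have hs : 0 < s := norm_pos_iff.2 hp
  -- If `v ∈ L` then `q = 0` and any unit vector of `Lᗮ` serves; one exists because `L` is proper.
  obtain ⟨e, heL, he1, hqe⟩ : ∃ e ∈ Lᗮ, ‖e‖ = 1 ∧ q = ‖q‖ • e := by
    by_cases hq : q = 0
    · have hfr := Submodule.finrank_add_finrank_orthogonal L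
      rw [finrank_euclideanSpace_fin] at hfr
      have : Lᗮ ≠ ⊥ := by
        intro h
        rw [h, finrank_bot] at hfr
        omega
      obtain ⟨x, hx, hx0⟩ := Submodule.exists_mem_ne_zero_of_ne_bot this
      refine ⟨‖x‖⁻¹ • x, Submodule.smul_mem _ _ hx, ?_, by simp [hq]⟩
      rw [norm_smul, norm_inv, norm_norm, inv_mul_cancel₀ (norm_ne_zero_iff.2 hx0)]
    · refine ⟨‖q‖⁻¹ • q, Submodule.smul_mem _ _ hqL, ?_, ?_⟩
      · rw [norm_smul, norm_inv, norm_norm, inv_mul_cancel₀ (norm_ne_zero_iff.2 hq)]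
      · rw [smul_smul, mul_inv_cancel₀ (norm_ne_zero_iff.2 hq), one_smul]
  set c := ‖q‖ with hcdef
  set a := s⁻¹ • p with hadef
  have haL : a ∈ L := Submodule.smul_mem _ _ hpL
  have ha1 : ‖a‖ = 1 := by
    rw [hadef, norm_smul, norm_inv, hsdef, norm_norm, inv_mul_cancel₀ (norm_ne_zero_iff.2 hp)]
  have hpa : p = s • a := by rw [hadef, smul_smul, mul_inv_cancel₀ hs.ne', one_smul]
  have hae : ⟪a, e⟫_ℝ = 0 := Submodule.inner_right_of_mem_orthogonal haL heL
  have hea : ⟪e, a⟫_ℝ = 0 := by rw [real_inner_comm, hae]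
  have haa : ⟪a, a⟫_ℝ = 1 := by rw [real_inner_self_eq_norm_sq, ha1]; norm_num
  have hee : ⟪e, e⟫_ℝ = 1 := by rw [real_inner_self_eq_norm_sq, he1]; norm_num
  have hvae : v = s • a + c • e := by rw [← hpa, ← hqe, hqdef]; abel
  have hsc : c ^ 2 + s ^ 2 = 1 := by
    have h : ⟪v, v⟫_ℝ = 1 := by rw [real_inner_self_eq_norm_sq, hv]; norm_num
    rw [hvae] at h
    simp only [inner_add_left, inner_add_right, real_inner_smul_left, real_inner_smul_right,
      haa, hee, hae, hea] at h
    linarith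
  -- `b` is the unit vector orthogonal to `v` in the plane of `a` and `e`. It replaces `a`, at an
  -- angle of sine `s = ‖p‖`, while the part `M` of `L` orthogonal to `a` is kept.
  set b := c • a - s • e with hbdef
  have hb1 : ‖b‖ = 1 := by
    have h : ‖b‖ ^ 2 = 1 := by
      rw [← real_inner_self_eq_norm_sq, hbdef]
      simp only [inner_sub_left, inner_sub_right, real_inner_smul_left, real_inner_smul_right,
        haa, hee, hae, hea]
      linarith
    exact (pow_eq_one_iff_of_nonneg (norm_nonneg b) two_ne_zero).1 h
  have hab : ⟪a, b⟫_ℝ = c := by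
    rw [hbdef, inner_sub_right, real_inner_smul_right a a, real_inner_smul_right a e, haa, hae]
    ring
  have hbv : ⟪b, v⟫_ℝ = 0 := by
    rw [hbdef, hvae]
    simp only [inner_sub_left, inner_add_right, real_inner_smul_left, real_inner_smul_right,
      haa, hee, hae, hea]
    ring
  set M := L ⊓ (ℝ ∙ a)ᗮ with hM
  have haM : a ∈ Mᗮ := by
    rw [Submodule.mem_orthogonal']
    intro x hx
    exact (Submodule.mem_orthogonal_singleton_iff_inner_right).1 hx.2
  have heM : e ∈ Mᗮ := Submodule.orthogonal_le inf_le_left heL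
  have hbM : b ∈ Mᗮ :=
    Submodule.sub_mem _ (Submodule.smul_mem _ _ haM) (Submodule.smul_mem _ _ heM)
  have hvM : v ∈ Mᗮ := by
    rw [hvae]
    exact Submodule.add_mem _ (Submodule.smul_mem _ _ haM) (Submodule.smul_mem _ _ heM)
  have hLM : L = M ⊔ ℝ ∙ a := by
    apply le_antisymm
    · intro x hx
      have h : x = (x - ⟪a, x⟫_ℝ • a) + ⟪a, x⟫_ℝ • a := by abel
      rw [h]
      refine Submodule.add_mem_sup ⟨Submodule.sub_mem _ hx (Submodule.smul_mem _ _ haL), ?_⟩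
        (Submodule.smul_mem _ _ (Submodule.mem_span_singleton_self a))
      rw [SetLike.mem_coe, Submodule.mem_orthogonal_singleton_iff_inner_right, inner_sub_right,
        real_inner_smul_right, haa]
      ring
    · refine sup_le inf_le_left ?_
      rwa [Submodule.span_singleton_le_iff_mem]
  refine ⟨M ⊔ ℝ ∙ b, ?_, ?_, ?_⟩
  · rw [hLM, finrank_sup_span_singleton M ha1 haM, finrank_sup_span_singleton M hb1 hbM]
  · rw [← Submodule.inf_orthogonal]
    exact ⟨hvM, Submodule.mem_orthogonal_singleton_iff_inner_right.2 hbv⟩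
  · refine ContinuousLinearMap.opNorm_le_bound _ hs.le fun x => ?_
    rw [sub_apply, starProjection_sup_span_singleton hLM ha1 haM,
      starProjection_sup_span_singleton rfl hb1 hbM,
      add_sub_add_left_eq_sub]
    exact norm_inner_smul_sub_inner_smul_le ha1 hb1 hs (by rw [hab]; exact hsc) x

/-- The distance of `L` to ill-posedness is the least norm of the projection onto `L` of a
nonnegative unit vector. -/
theorem exists_isLeast_illPosedDistances {L : Submodule ℝ (EuclideanSpace ℝ (Fin m))}
    (hL : Module.finrank ℝ L < m) (hpos : MeetsPos L) :
    ∃ v : EuclideanSpace ℝ (Fin m), (∀ i, 0 ≤ v i) ∧ ‖v‖ = 1 ∧ 0 < ‖L.starProjection v‖ ∧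
      IsLeast (illPosedDistances L) ‖L.starProjection v‖ ∧
      ∀ w : EuclideanSpace ℝ (Fin m), (∀ i, 0 ≤ w i) →
        ‖L.starProjection v‖ * ‖w‖ ≤ ‖L.starProjection w‖ := by
  have hne : ∀ v : EuclideanSpace ℝ (Fin m), (∀ i, 0 ≤ v i) → ‖v‖ = 1 →
      L.starProjection v ≠ 0 := by
    intro v hv hv1 h0
    exact not_meetsPos_of_mem_orthogonal ((Submodule.starProjection_apply_eq_zero_iff _).1 h0) hv
      (by rintro rfl; simp at hv1) hpos
  have hclosed : IsClosed {v : EuclideanSpace ℝ (Fin m) | ∀ i, 0 ≤ v i} := by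
    simp only [Set.ofPred_forall]
    exact isClosed_iInter fun i => isClosed_le continuous_const (by fun_prop)
  have hcomp : IsCompact
      (Metric.sphere (0 : EuclideanSpace ℝ (Fin m)) 1 ∩ {v | ∀ i, 0 ≤ v i}) :=
    (isCompact_sphere 0 1).inter_right hclosed
  have hm : 0 < m := by omega
  have hnonempty : (Metric.sphere (0 : EuclideanSpace ℝ (Fin m)) 1 ∩
      {v | ∀ i, 0 ≤ v i}).Nonempty := by
    refine ⟨EuclideanSpace.single ⟨0, hm⟩ 1, by simp, fun i => ?_⟩
    by_cases h : i = ⟨0, hm⟩ <;> simp [h]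
  obtain ⟨v, ⟨hv1, hv⟩, hmin⟩ := hcomp.exists_isMinOn hnonempty
    (f := fun v => ‖L.starProjection v‖) (by fun_prop)
  have hv1 : ‖v‖ = 1 := by simpa using hv1
  have hmin : ∀ w : EuclideanSpace ℝ (Fin m), (∀ i, 0 ≤ w i) → ‖w‖ = 1 →
      ‖L.starProjection v‖ ≤ ‖L.starProjection w‖ :=
    fun w hw hw1 => hmin ⟨by simpa using hw1, hw⟩
  refine ⟨v, hv, hv1, norm_pos_iff.2 (hne v hv hv1), ⟨?_, ?_⟩, ?_⟩
  · obtain ⟨L', hfr, hvL', hd⟩ := exists_finrank_eq_mem_orthogonal_grassDist_le hL hv1 (hne v hv hv1)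
    exact ⟨L', hfr, not_meetsPos_of_mem_orthogonal hvL' hv (by rintro rfl; simp at hv1),
      le_antisymm (norm_starProjection_le_grassDist L hvL' hv1) hd⟩
  · rintro r ⟨L', -, hL', rfl⟩
    obtain ⟨w, hwL', hw1, hw⟩ := exists_nonneg_mem_orthogonal_of_not_meetsPos hL'
    exact (hmin w hw hw1).trans (norm_starProjection_le_grassDist L hwL' hw1)
  · intro w hw
    by_cases hw0 : w = 0
    · simp [hw0]
    have hwp : 0 < ‖w‖ := norm_pos_iff.2 hw0
    have h := hmin (‖w‖⁻¹ • w)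
      (fun i => by simpa using mul_nonneg (inv_nonneg.2 hwp.le) (hw i))
      (by rw [norm_smul, norm_inv, norm_norm, inv_mul_cancel₀ hwp.ne'])
    rw [map_smul, norm_smul, norm_inv, norm_norm, inv_mul_eq_div, le_div_iff₀ hwp] at h
    exact h

end IllPosed

/-! ### Signatures as isometries -/

section SignatureScaling

variable {m n : ℕ}

theorem toEuclideanCLM_diagonal_apply (d : Fin m → ℝ) (x : EuclideanSpace ℝ (Fin m)) (i : Fin m) :
    Matrix.toEuclideanCLM (𝕜 := ℝ) (Matrix.diagonal d) x i = d i * x i := by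
  rw [Matrix.ofLp_toEuclideanCLM, Matrix.mulVec_diagonal]

theorem mem_imageSpace {A : Matrix (Fin m) (Fin n) ℝ} {y : EuclideanSpace ℝ (Fin m)} :
    y ∈ imageSpace A ↔ ∃ x : Fin n → ℝ, y = WithLp.toLp 2 (A.mulVec x) := by
  constructor
  · rintro ⟨x, rfl⟩
    exact ⟨x, rfl⟩
  · rintro ⟨x, rfl⟩
    exact ⟨WithLp.toLp 2 x, rfl⟩

theorem mem_imageSpace_mul {A : Matrix (Fin m) (Fin n) ℝ} {S : Matrix (Fin m) (Fin m) ℝ}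
    {y : EuclideanSpace ℝ (Fin m)} :
    y ∈ imageSpace (S * A) ↔ ∃ x ∈ imageSpace A, y = Matrix.toEuclideanCLM (𝕜 := ℝ) S x := by
  constructor
  · intro h
    obtain ⟨x, rfl⟩ := mem_imageSpace.1 h
    exact ⟨_, mem_imageSpace.2 ⟨x, rfl⟩, by
      rw [Matrix.toEuclideanCLM_toLp, Matrix.mulVec_mulVec]⟩
  · rintro ⟨x, hx, rfl⟩
    obtain ⟨x, rfl⟩ := mem_imageSpace.1 hx
    exact mem_imageSpace.2 ⟨x, by rw [Matrix.toEuclideanCLM_toLp, Matrix.mulVec_mulVec]⟩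

theorem inner_signature {s : Fin m → ℝ} (hs : ∀ i, s i = 1 ∨ s i = -1)
    (x y : EuclideanSpace ℝ (Fin m)) :
    ⟪Matrix.toEuclideanCLM (𝕜 := ℝ) (Matrix.diagonal s) x,
      Matrix.toEuclideanCLM (𝕜 := ℝ) (Matrix.diagonal s) y⟫_ℝ = ⟪x, y⟫_ℝ := by
  simp only [PiLp.inner_apply, RCLike.inner_apply, conj_trivial, toEuclideanCLM_diagonal_apply]
  refine Finset.sum_congr rfl fun i _ => ?_
  rcases hs i with h | h <;> rw [h] <;> ring

theorem norm_signature {s : Fin m → ℝ} (hs : ∀ i, s i = 1 ∨ s i = -1)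
    (x : EuclideanSpace ℝ (Fin m)) :
    ‖Matrix.toEuclideanCLM (𝕜 := ℝ) (Matrix.diagonal s) x‖ = ‖x‖ := by
  rw [norm_eq_sqrt_real_inner, inner_signature hs, ← norm_eq_sqrt_real_inner]

/-- The signature is an isometry carrying one image onto the other, so it intertwines the
projections. -/
theorem norm_starProjection_signature {s : Fin m → ℝ} (hs : ∀ i, s i = 1 ∨ s i = -1)
    (A : Matrix (Fin m) (Fin n) ℝ)
    (x : EuclideanSpace ℝ (Fin m)) :
    ‖(imageSpace (Matrix.diagonal s * A)).starProjection
      (Matrix.toEuclideanCLM (𝕜 := ℝ) (Matrix.diagonal s) x)‖ =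
      ‖(imageSpace A).starProjection x‖ := by
  rw [← norm_signature hs ((imageSpace A).starProjection x)]
  congr 1
  apply Submodule.eq_starProjection_of_mem_of_inner_eq_zero
  · exact mem_imageSpace_mul.2 ⟨_, Submodule.starProjection_apply_mem _ x, rfl⟩
  · intro w hw
    obtain ⟨z, hz, rfl⟩ := mem_imageSpace_mul.1 hw
    rw [← map_sub, inner_signature hs]
    exact Submodule.starProjection_inner_eq_zero x z hz

end SignatureScaling

/-! ### Transposed weighted projections -/

section WeightedProjection

variable {m n : ℕ} {A : Matrix (Fin m) (Fin n) ℝ}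

theorem mulVec_injective_of_rank_eq (hrank : A.rank = n) : Function.Injective A.mulVec := by
  have h := LinearMap.finrank_range_add_finrank_ker A.mulVecLin
  rw [Module.finrank_fin_fun] at h
  have hk : Module.finrank ℝ (LinearMap.ker A.mulVecLin) = 0 := by
    have : Module.finrank ℝ (LinearMap.range A.mulVecLin) = n := hrank
    omega
  exact LinearMap.ker_eq_bot.1 (Submodule.finrank_eq_zero.1 hk)

theorem finrank_imageSpace_le : Module.finrank ℝ (imageSpace A) ≤ n := by
  have h := LinearMap.finrank_range_le (Matrix.toEuclideanLin A)
  rwa [finrank_euclideanSpace_fin] at h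

theorem isUnit_transpose_mul_diagonal_mul (hrank : A.rank = n) {d : Fin m → ℝ}
    (hd : ∀ i, 0 < d i) : IsUnit (A.transpose * Matrix.diagonal d * A) := by
  have hpd : (Matrix.diagonal d).PosDef := Matrix.PosDef.diagonal hd
  have := hpd.conjTranspose_mul_mul_same (mulVec_injective_of_rank_eq hrank)
  rw [Matrix.conjTranspose_eq_transpose_of_trivial] at this
  exact this.isUnit

theorem opNorm_transpose (M : Matrix (Fin m) (Fin m) ℝ) : opNorm M.transpose = opNorm M := by
  rw [← Matrix.conjTranspose_eq_transpose_of_trivial, ← Matrix.star_eq_conjTranspose, opNorm,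
    map_star]
  exact ContinuousLinearMap.adjoint.norm_map (Matrix.toEuclideanCLM (𝕜 := ℝ) M)

theorem transpose_mul_weightedPinv (A : Matrix (Fin m) (Fin n) ℝ) (d : Fin m → ℝ) :
    (A * weightedPinv A (Matrix.diagonal d)).transpose =
      Matrix.diagonal d * A * (A.transpose * Matrix.diagonal d * A)⁻¹ * A.transpose := by
  have hsymm : (A.transpose * Matrix.diagonal d * A).transpose =
      A.transpose * Matrix.diagonal d * A := by
    simp [Matrix.transpose_mul, Matrix.mul_assoc]
  rw [weightedPinv, Matrix.transpose_mul, Matrix.transpose_mul, Matrix.transpose_mul,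
    Matrix.transpose_nonsing_inv, hsymm, Matrix.diagonal_transpose, Matrix.transpose_transpose]
  simp only [Matrix.mul_assoc]

/-- The transpose of a weighted projection fixes `D y` for `y` in the image of `A`. -/
theorem transpose_mul_weightedPinv_mul (hrank : A.rank = n) {d : Fin m → ℝ}
    (hd : ∀ i, 0 < d i) :
    (A * weightedPinv A (Matrix.diagonal d)).transpose * (Matrix.diagonal d * A) =
      Matrix.diagonal d * A := by
  have hu := (Matrix.isUnit_iff_isUnit_det _).1 (isUnit_transpose_mul_diagonal_mul hrank hd)
  rw [transpose_mul_weightedPinv, Matrix.mul_assoc, ← Matrix.mul_assoc A.transpose,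
    Matrix.mul_assoc, Matrix.nonsing_inv_mul _ hu, Matrix.mul_one]

theorem transpose_mul_transpose_mul_weightedPinv (hrank : A.rank = n) {d : Fin m → ℝ}
    (hd : ∀ i, 0 < d i) :
    A.transpose * (A * weightedPinv A (Matrix.diagonal d)).transpose = A.transpose := by
  have hu := (Matrix.isUnit_iff_isUnit_det _).1 (isUnit_transpose_mul_diagonal_mul hrank hd)
  rw [transpose_mul_weightedPinv, ← Matrix.mul_assoc, ← Matrix.mul_assoc, ← Matrix.mul_assoc,
    Matrix.mul_nonsing_inv _ hu, Matrix.one_mul]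

theorem mem_orthogonal_imageSpace {z : EuclideanSpace ℝ (Fin m)} :
    z ∈ (imageSpace A)ᗮ ↔ A.transpose.mulVec z = 0 := by
  have hin : ∀ x : Fin n → ℝ,
      ⟪WithLp.toLp 2 (A.mulVec x), z⟫_ℝ = A.transpose.mulVec z ⬝ᵥ x := by
    intro x
    rw [EuclideanSpace.inner_eq_star_dotProduct, star_trivial, Matrix.dotProduct_mulVec,
      Matrix.mulVec_transpose]
  rw [Submodule.mem_orthogonal]
  constructor
  · intro h
    refine dotProduct_eq_zero _ fun x => ?_
    rw [← hin]
    exact h _ (mem_imageSpace.2 ⟨x, rfl⟩)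
  · rintro h y hy
    obtain ⟨x, rfl⟩ := mem_imageSpace.1 hy
    rw [hin, h, zero_dotProduct]

/-- The transpose `Q` fixes `z = D y` and kills `Lᗮ`, so `z = Q z = Q (Π z)`. -/
theorem norm_diagonal_le_opNorm_mul (hrank : A.rank = n) {d : Fin m → ℝ} (hd : ∀ i, 0 < d i)
    {y : EuclideanSpace ℝ (Fin m)} (hy : y ∈ imageSpace A) :
    ‖Matrix.toEuclideanCLM (𝕜 := ℝ) (Matrix.diagonal d) y‖ ≤
      opNorm (A * weightedPinv A (Matrix.diagonal d)) *
        ‖(imageSpace A).starProjection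
          (Matrix.toEuclideanCLM (𝕜 := ℝ) (Matrix.diagonal d) y)‖ := by
  obtain ⟨x, rfl⟩ := mem_imageSpace.1 hy
  set z := Matrix.toEuclideanCLM (𝕜 := ℝ) (Matrix.diagonal d) (WithLp.toLp 2 (A.mulVec x)) with hz
  set Q := (A * weightedPinv A (Matrix.diagonal d)).transpose with hQ
  have hfix : Matrix.toEuclideanCLM (𝕜 := ℝ) Q z = z := by
    rw [hz, Matrix.toEuclideanCLM_toLp, Matrix.toEuclideanCLM_toLp, Matrix.mulVec_mulVec,
      Matrix.mulVec_mulVec, Matrix.mul_assoc, hQ, transpose_mul_weightedPinv_mul hrank hd,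
      Matrix.mulVec_mulVec]
  have hproj : Matrix.toEuclideanCLM (𝕜 := ℝ) Q ((imageSpace A).starProjection z) = z := by
    have h0 := mem_orthogonal_imageSpace.1
      (Submodule.sub_starProjection_mem_orthogonal (K := imageSpace A) z)
    have h1 : Matrix.toEuclideanCLM (𝕜 := ℝ) Q (z - (imageSpace A).starProjection z) = 0 := by
      ext i
      rw [Matrix.ofLp_toEuclideanCLM, hQ, transpose_mul_weightedPinv, ← Matrix.mulVec_mulVec, h0,
        Matrix.mulVec_zero]
      rfl
    rw [map_sub, hfix, sub_eq_zero] at h1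
    exact h1.symm
  rw [← opNorm_transpose, ← hQ]
  calc ‖z‖ = ‖Matrix.toEuclideanCLM (𝕜 := ℝ) Q ((imageSpace A).starProjection z)‖ := by rw [hproj]
    _ ≤ _ := ContinuousLinearMap.le_opNorm _ _

/-- The transpose `Q` takes values in `D L`, and `Aᵀ Q = Aᵀ` gives `Π (Q z) = Π z`; apply `h` to `Q
z`. -/
theorem opNorm_mul_weightedPinv_le (hrank : A.rank = n) {d : Fin m → ℝ} (hd : ∀ i, 0 < d i)
    {C : ℝ} (hC : 0 ≤ C)
    (h : ∀ y ∈ imageSpace A, ‖Matrix.toEuclideanCLM (𝕜 := ℝ) (Matrix.diagonal d) y‖ ≤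
      C * ‖(imageSpace A).starProjection
        (Matrix.toEuclideanCLM (𝕜 := ℝ) (Matrix.diagonal d) y)‖) :
    opNorm (A * weightedPinv A (Matrix.diagonal d)) ≤ C := by
  rw [← opNorm_transpose]
  set Q := (A * weightedPinv A (Matrix.diagonal d)).transpose with hQ
  refine ContinuousLinearMap.opNorm_le_bound _ hC fun z => ?_
  obtain ⟨y, hy, hQy⟩ : ∃ y ∈ imageSpace A, Matrix.toEuclideanCLM (𝕜 := ℝ) Q z =
      Matrix.toEuclideanCLM (𝕜 := ℝ) (Matrix.diagonal d) y := by
    refine ⟨WithLp.toLp 2 (A.mulVec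
      (((A.transpose * Matrix.diagonal d * A)⁻¹ * A.transpose).mulVec z)),
      mem_imageSpace.2 ⟨_, rfl⟩, ?_⟩
    ext1
    rw [Matrix.toEuclideanCLM_toLp, Matrix.ofLp_toEuclideanCLM, Matrix.mulVec_mulVec,
      Matrix.mulVec_mulVec, hQ, transpose_mul_weightedPinv]
    simp only [Matrix.mul_assoc]
  have hproj : (imageSpace A).starProjection (Matrix.toEuclideanCLM (𝕜 := ℝ) Q z) =
      (imageSpace A).starProjection z := by
    rw [← sub_eq_zero, ← map_sub, Submodule.starProjection_apply_eq_zero_iff,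
      mem_orthogonal_imageSpace, WithLp.ofLp_sub, Matrix.mulVec_sub, Matrix.ofLp_toEuclideanCLM,
      Matrix.mulVec_mulVec, hQ, transpose_mul_transpose_mul_weightedPinv hrank hd, sub_self]
  calc ‖Matrix.toEuclideanCLM (𝕜 := ℝ) Q z‖
      ≤ C * ‖(imageSpace A).starProjection (Matrix.toEuclideanCLM (𝕜 := ℝ) Q z)‖ := by
        rw [hQy]
        exact h y hy
    _ ≤ C * ‖z‖ := by
        rw [hproj]
        exact mul_le_mul_of_nonneg_left (Submodule.norm_starProjection_apply_le _ z) hC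

end WeightedProjection

/-! ### Sign patterns and the two inequalities -/

section SignPatterns

variable {m n : ℕ} {A : Matrix (Fin m) (Fin n) ℝ}

/-- Each nonzero row is a nonzero functional, and finitely many proper hyperplanes do not cover a
real vector space. -/
theorem exists_mem_imageSpace_forall_ne_zero (hrow : ∀ i, A i ≠ 0) :
    ∃ y ∈ imageSpace A, ∀ i, y i ≠ 0 := by
  obtain ⟨x, hx⟩ := Module.Dual.exists_forall_ne_zero_of_forall_exists
    (fun i => (LinearMap.proj i).comp A.mulVecLin) (fun i => by
      obtain ⟨j, hj⟩ := Function.ne_iff.1 (hrow i)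
      exact ⟨Pi.single j 1, by simpa using hj⟩)
  exact ⟨WithLp.toLp 2 (A.mulVec x), mem_imageSpace.2 ⟨x, rfl⟩, hx⟩

/-- A vector of `L` can be perturbed within `L` to one without zero entries and compatible
signs. -/
theorem exists_mem_forall_ne_zero_forall_mul_nonneg {L : Submodule ℝ (EuclideanSpace ℝ (Fin m))}
    (hL : ∃ y ∈ L, ∀ i, y i ≠ 0) {y : EuclideanSpace ℝ (Fin m)} (hy : y ∈ L) :
    ∃ z ∈ L, ∀ i, z i ≠ 0 ∧ 0 ≤ z i * y i := by
  obtain ⟨w, hwL, hw⟩ := hL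
  have hev : ∀ᶠ ε : ℝ in nhdsWithin 0 (Set.Ioi 0),
      ∀ i, (y i + ε * w i) ≠ 0 ∧ 0 ≤ (y i + ε * w i) * y i := by
    rw [Filter.eventually_all]
    intro i
    by_cases hyi : y i = 0
    · filter_upwards [self_mem_nhdsWithin] with ε hε
      simp only [hyi, zero_add, mul_zero, le_refl, and_true]
      exact mul_ne_zero (ne_of_gt hε) (hw i)
    · have hc : Filter.Tendsto (fun ε : ℝ => (y i + ε * w i) * y i) (nhds 0)
          (nhds ((y i + 0 * w i) * y i)) :=
        Continuous.tendsto (by fun_prop) 0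
      have hpos : 0 < (y i + 0 * w i) * y i := by
        rw [zero_mul, add_zero]
        exact mul_self_pos.2 hyi
      filter_upwards [nhdsWithin_le_nhds (hc.eventually (lt_mem_nhds hpos))] with ε hε
      exact ⟨left_ne_zero_of_mul hε.ne', hε.le⟩
  obtain ⟨ε, hε⟩ := hev.exists
  exact ⟨y + ε • w, L.add_mem hy (L.smul_mem _ hwL), fun i => by simpa using hε i⟩

/-- The signature matrix of the sign pattern of a vector of the image makes that vector
positive. -/
theorem exists_signature_meetsPos {y : EuclideanSpace ℝ (Fin m)} (hy : y ∈ imageSpace A)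
    (hne : ∀ i, y i ≠ 0) :
    ∃ s : Fin m → ℝ, (∀ i, s i = 1 ∨ s i = -1) ∧ (∀ i, 0 < s i * y i) ∧
      MeetsPos (imageSpace (Matrix.diagonal s * A)) := by
  have hpos : ∀ i, 0 < (if 0 < y i then (1 : ℝ) else -1) * y i := by
    intro i
    rcases (hne i).lt_or_gt with h | h
    · simp [not_lt.2 h.le, h]
    · simp [h]
  refine ⟨fun i => if 0 < y i then 1 else -1, fun i => by dsimp only; split_ifs <;> simp, hpos,
    _, mem_imageSpace_mul.2 ⟨y, hy, rfl⟩, fun i => ?_⟩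
  rw [toEuclideanCLM_diagonal_apply]
  exact hpos i

theorem finite_signatures (m : ℕ) : (signatures m).Finite := by
  have h : (Set.pi Set.univ fun _ : Fin m => ({1, -1} : Set ℝ)).Finite :=
    Set.Finite.pi fun _ => Set.toFinite _
  refine (h.image Matrix.diagonal).subset ?_
  rintro S ⟨s, hs, rfl⟩
  exact ⟨s, fun i _ => hs i, rfl⟩

/-- The Grassmannian condition number bounds the norm of a nonnegative vector by that of its
projection, and the bound is sharp. -/
theorem grassCond_spec (hnm : n < m) (B : Matrix (Fin m) (Fin n) ℝ)
    (hB : MeetsPos (imageSpace B)) :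
    (∃ d : ℝ, 0 < d ∧ IsLeast (illPosedDistances (imageSpace B)) d) ∧ 0 < grassCond B ∧
      (∀ w : EuclideanSpace ℝ (Fin m), (∀ i, 0 ≤ w i) →
        ‖w‖ ≤ grassCond B * ‖(imageSpace B).starProjection w‖) ∧
      ∃ v : EuclideanSpace ℝ (Fin m), (∀ i, 0 ≤ v i) ∧ v ≠ 0 ∧
        ‖v‖ = grassCond B * ‖(imageSpace B).starProjection v‖ := by
  obtain ⟨v, hv, hv1, hpos, hleast, hmin⟩ :=
    exists_isLeast_illPosedDistances (finrank_imageSpace_le.trans_lt hnm) hB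
  have hg : grassCond B = 1 / ‖(imageSpace B).starProjection v‖ := by
    rw [grassCond, hleast.csInf_eq]
  refine ⟨⟨_, hpos, hleast⟩, by rw [hg]; positivity, fun w hw => ?_, v, hv,
    by rintro rfl; simp at hv1, ?_⟩
  · rw [hg, one_div, inv_mul_eq_div, le_div_iff₀ hpos, mul_comm]
    exact hmin w hw
  · rw [hg, hv1, one_div, inv_mul_cancel₀ hpos.ne']

/-- Zero entries of `y` leave its signature undetermined; the signs of a nearby `z ∈ L` without
zeros make `D y` nonnegative and ensure that `S L` meets the open orthant. -/
theorem opNorm_le_of_forall_grassCond_le (hnm : n < m) (hrank : A.rank = n)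
    (hrow : ∀ i, A i ≠ 0) {C : ℝ} (hC0 : 0 ≤ C)
    (hC : ∀ S ∈ signatures m, MeetsPos (imageSpace (S * A)) → grassCond (S * A) ≤ C)
    {d : Fin m → ℝ} (hd : ∀ i, 0 < d i) :
    opNorm (A * weightedPinv A (Matrix.diagonal d)) ≤ C := by
  refine opNorm_mul_weightedPinv_le hrank hd hC0 fun y hy => ?_
  obtain ⟨z, hzL, hz⟩ := exists_mem_forall_ne_zero_forall_mul_nonneg
    (exists_mem_imageSpace_forall_ne_zero hrow) hy
  obtain ⟨s, hs, hsz, hmeet⟩ := exists_signature_meetsPos hzL fun i => (hz i).1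
  have hS : Matrix.diagonal s ∈ signatures m := ⟨s, hs, rfl⟩
  obtain ⟨-, -, hbound, -⟩ := grassCond_spec hnm _ hmeet
  set x := Matrix.toEuclideanCLM (𝕜 := ℝ) (Matrix.diagonal d) y with hx
  have hnonneg : ∀ i, 0 ≤ Matrix.toEuclideanCLM (𝕜 := ℝ) (Matrix.diagonal s) x i := by
    intro i
    rw [hx, toEuclideanCLM_diagonal_apply, toEuclideanCLM_diagonal_apply]
    have h1 : 0 ≤ s i * y i := by
      have h2 : 0 ≤ (s i * z i) * (s i * y i) := by
        have h3 : s i * s i = 1 := by rcases hs i with h | h <;> rw [h] <;> norm_num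
        calc (0 : ℝ) ≤ z i * y i := (hz i).2
          _ = (s i * s i) * (z i * y i) := by rw [h3, one_mul]
          _ = _ := by ring
      exact nonneg_of_mul_nonneg_right h2 (hsz i)
    calc (0 : ℝ) ≤ d i * (s i * y i) := mul_nonneg (hd i).le h1
      _ = _ := by ring
  have h := hbound _ hnonneg
  rw [norm_signature hs, norm_starProjection_signature hs] at h
  exact h.trans (mul_le_mul_of_nonneg_right (hC _ hS hmeet) (norm_nonneg _))

/-- The extremal `v` may have zero entries and so lie in no `S D L`. The positive vector `v + ε • y`
does lie in one, and `ε → 0` gives the bound. -/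
theorem grassCond_le_of_forall_opNorm_le (hnm : n < m) (hrank : A.rank = n) {C : ℝ}
    (hC : ∀ d : Fin m → ℝ, (∀ i, 0 < d i) →
      opNorm (A * weightedPinv A (Matrix.diagonal d)) ≤ C)
    {S : Matrix (Fin m) (Fin m) ℝ} (hS : S ∈ signatures m)
    (hmeet : MeetsPos (imageSpace (S * A))) : grassCond (S * A) ≤ C := by
  obtain ⟨s, hs, rfl⟩ := hS
  obtain ⟨-, hgpos, -, v, hv, hvne, hveq⟩ := grassCond_spec hnm _ hmeet
  obtain ⟨y, hyL, hy⟩ := hmeet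
  obtain ⟨x, hxL, rfl⟩ := mem_imageSpace_mul.1 hyL
  set y := Matrix.toEuclideanCLM (𝕜 := ℝ) (Matrix.diagonal s) x with hydef
  set L := imageSpace (Matrix.diagonal s * A) with hL
  have hε : ∀ ε : ℝ, 0 < ε → ‖v + ε • y‖ ≤ C * ‖L.starProjection (v + ε • y)‖ := by
    intro ε hε
    -- These weights carry the positive vector `y = S x` to `v + ε • y`.
    have hd : ∀ i, 0 < (v i + ε * y i) / y i := fun i =>
      div_pos (add_pos_of_nonneg_of_pos (hv i) (mul_pos hε (hy i))) (hy i)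
    have hcomm : Matrix.toEuclideanCLM (𝕜 := ℝ) (Matrix.diagonal s)
        (Matrix.toEuclideanCLM (𝕜 := ℝ) (Matrix.diagonal fun i => (v i + ε * y i) / y i) x) =
        v + ε • y := by
      ext i
      have hyi : y i = s i * x i := toEuclideanCLM_diagonal_apply s x i
      rw [toEuclideanCLM_diagonal_apply, toEuclideanCLM_diagonal_apply, mul_left_comm, ← hyi,
        div_mul_cancel₀ _ (hy i).ne']
      simp
    rw [← hcomm, norm_signature hs, norm_starProjection_signature hs]
    exact (norm_diagonal_le_opNorm_mul hrank hd hxL).trans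
      (mul_le_mul_of_nonneg_right (hC _ hd) (norm_nonneg _))
  have hlim : ‖v‖ ≤ C * ‖L.starProjection v‖ := by
    have h1 : Filter.Tendsto (fun ε : ℝ => ‖v + ε • y‖) (nhdsWithin 0 (Set.Ioi 0))
        (nhds ‖v + (0 : ℝ) • y‖) :=
      (Continuous.tendsto (by fun_prop) 0).mono_left nhdsWithin_le_nhds
    have h2 : Filter.Tendsto (fun ε : ℝ => C * ‖L.starProjection (v + ε • y)‖)
        (nhdsWithin 0 (Set.Ioi 0)) (nhds (C * ‖L.starProjection (v + (0 : ℝ) • y)‖)) :=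
      (Continuous.tendsto (by fun_prop) 0).mono_left nhdsWithin_le_nhds
    have h := le_of_tendsto_of_tendsto h1 h2
      (by filter_upwards [self_mem_nhdsWithin] with ε h using hε ε h)
    simpa using h
  rw [hveq] at hlim
  refine le_of_mul_le_mul_right hlim ?_
  have hvpos : 0 < ‖v‖ := norm_pos_iff.2 hvne
  rw [hveq] at hvpos
  exact pos_of_mul_pos_right hvpos hgpos.le

end SignPatterns

/-- Besides the identity, the conclusion records that the supremum defining `χ̄(A)` is finite and
that each minimum defining `G(SA)` is attained and positive, so that no junk value occurs. -/
theorem corollary2 (m n : ℕ) (hnm : n < m) (A : Matrix (Fin m) (Fin n) ℝ)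
    (hrank : A.rank = n) (hrow : ∀ i, A i ≠ 0) :
    BddAbove (chiBarSet A) ∧
    (∀ S ∈ signatures m, MeetsPos (imageSpace (S * A)) →
      ∃ d : ℝ, 0 < d ∧ IsLeast (illPosedDistances (imageSpace (S * A))) d) ∧
    IsGreatest {g : ℝ | ∃ S ∈ signatures m, MeetsPos (imageSpace (S * A)) ∧
      g = grassCond (S * A)} (chiBar A) := by
  have hG : ∀ S ∈ signatures m, MeetsPos (imageSpace (S * A)) → 0 < grassCond (S * A) :=
    fun S _ h => (grassCond_spec hnm _ h).2.1
  set G : Set ℝ := {g : ℝ | ∃ S ∈ signatures m, MeetsPos (imageSpace (S * A)) ∧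
      g = grassCond (S * A)} with hGdef
  have hfin : G.Finite := by
    refine ((finite_signatures m).image fun S => grassCond (S * A)).subset ?_
    rintro g ⟨S, hS, -, rfl⟩
    exact ⟨S, hS, rfl⟩
  have hne : G.Nonempty := by
    obtain ⟨y, hyL, hy⟩ := exists_mem_imageSpace_forall_ne_zero hrow
    obtain ⟨s, hs, -, hmeet⟩ := exists_signature_meetsPos hyL hy
    exact ⟨_, _, ⟨s, hs, rfl⟩, hmeet, rfl⟩
  obtain ⟨g, hgG, hgmax⟩ := hfin.exists_maximal hne
  have hgub : ∀ g' ∈ G, g' ≤ g := fun g' hg' => (le_total g' g).elim id fun h => hgmax hg' h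
  have hg0 : 0 ≤ g := by
    obtain ⟨S, hS, hmeet, rfl⟩ := hgG
    exact (hG S hS hmeet).le
  have hub : ∀ d : Fin m → ℝ, (∀ i, 0 < d i) →
      opNorm (A * weightedPinv A (Matrix.diagonal d)) ≤ g := fun d hd =>
    opNorm_le_of_forall_grassCond_le hnm hrank hrow hg0
      (fun S hS hmeet => hgub _ ⟨S, hS, hmeet, rfl⟩) hd
  have hbdd : ∀ r ∈ chiBarSet A, r ≤ g := by
    rintro r ⟨D, ⟨d, hd, rfl⟩, rfl⟩
    exact hub d hd
  have hBA : BddAbove (chiBarSet A) := ⟨g, hbdd⟩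
  have hcne : (chiBarSet A).Nonempty :=
    ⟨_, Matrix.diagonal fun _ => 1, ⟨_, fun _ => one_pos, rfl⟩, rfl⟩
  have hle : ∀ g' ∈ G, g' ≤ chiBar A := by
    rintro g' ⟨S, hS, hmeet, rfl⟩
    exact grassCond_le_of_forall_opNorm_le hnm hrank
      (fun d hd => le_csSup hBA ⟨_, ⟨d, hd, rfl⟩, rfl⟩) hS hmeet
  have heq : chiBar A = g := le_antisymm (csSup_le hcne hbdd) (hle g hgG)
  exact ⟨hBA, fun S _ hmeet => (grassCond_spec hnm _ hmeet).1, heq ▸ hgG, hle⟩
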